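/- A simplicial complex is a family of finite sets (faces, the empty set included) closed under taking subsets; $\langle F_1,\dots,F_j\rangle$ is the complex of all subsets of the $F_i$; $\dim\sigma=|\sigma|-1$, and the dimension of a complex is the maximum of the dimensions of its faces. For a face $\sigma$ of $K$, $\operatorname{link}_K\sigma=\{\tau\in K : \tau\cup\sigma\in K,\ \tau\cap\sigma=\varnothing\}$. Fix a field $\Bbbk$. A complex is acyclic if all its reduced simplicial homology groups over $\Bbbk$ vanish, and $K$ is $k$-fold acyclic if $\operatorname{link}_K\sigma$ is acyclic for every face $\sigma\in K$ with $|\sigma|<k$. A rank $k$ boolean interval of a poset $P$ is an interval $[x,y]\subseteq P$ isomorphic to the poset $2^{[k]}$ of subsets of $[k]=\{1,\dots,k\}$. Stanley's Conjecture 2.4 asserts: for every $k\ge 0$, the face poset of every finite $k$-fold acyclic simplicial complex is a disjoint union of rank $k$ boolean intervals, the minimal faces of which together form a subcomplex. On the vertices $A,B,\dots,L$ (writing $ABCE$ for $\{A,B,C,E\}$, and so on) let \[ \Gamma=\langle ABCE, BCEF, BCDF, ABCG, BCGH, BCDH, ABEG, BEFG, BFHG\rangle \] and let $\Delta$ be the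 complex generated by the nine sets above together with \[ \begin{array}{lllll} ABCJ,& ABIJ,& BCIJ,& BCDI,& CDIJ,\\ ABEK,& ABIK,& BEIK,& BEFI,& EFIK,\\ ABGL,& ABIL,& BGIL,& BGHI,& GHIL,\\ CDFK,& CDJK,& CFJK,& CEFJ,& EFJK,\\ CDHL,& CDJL,& CHJL,& CGHJ,& GHJL,\\ EFGL,& EFKL,& FGKL,& FGHK,& GHKL. \end{array} \] Let $\Omega_{17}$ be the complex obtained by gluing $17$ copies of $\Delta$ together along $\Gamma$, that is, the union of $17$ copies of $\Delta$ in which the vertices of $\Gamma$ are shared by all copies and the other vertices of different copies are distinct. Then, for every field $\Bbbk$: (1) $\Gamma$ is a simplicial $3$-ball (its geometric realization is homeomorphic to the closed unit ball of $\mathbb R^3$) and an induced subcomplex of $\Delta$ (that is, $\Gamma=\{\sigma\in\Delta:\sigma\subseteq W\}$ for some set $W$ of vertices); (2) $\Omega_{17}$ is $3$-dimensional and $2$-fold acyclic over $\Bbbk$; (3) the face poset of $\Omega_{17}$ is not a disjoint union of rank $2$ boolean intervals. Consequently, Stanley's Conjecture 2.4 is false over every field. -/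

import Mathlib

namespace BoolDecomp

/-- A simplicial complex with vertices in `V`: a set of finite subsets of `V` that is closed under
taking subsets. The empty set is allowed as a face. -/
abbrev Complex (V : Type*) := LowerSet (Finset V)

/-- The complex `⟨F₁, …, Fⱼ⟩` of all subsets of the sets `F₁, …, Fⱼ`. -/
def generated {V : Type*} (F : Set (Finset V)) : Complex V := lowerClosure F

/-- `dim K = d`: the maximum of `dim σ = |σ| - 1` over the faces `σ` of `K` exists and is `d`. -/
def HasDim {V : Type*} (K : Complex V) (d : ℤ) : Prop :=
  IsGreatest {i : ℤ | ∃ σ ∈ K, i = (σ.card : ℤ) - 1} d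

/-- The induced subcomplex `K|_W`. -/
def induced {V : Type*} (K : Complex V) (W : Set V) : Complex V where
  carrier := {σ | σ ∈ K ∧ (σ : Set V) ⊆ W}
  lower' := fun _ _ hτσ hσ => ⟨K.lower hτσ hσ.1, fun _ hv => hσ.2 (hτσ hv)⟩

/-- `L` is an induced subcomplex of `K`. -/
def IsInducedSubcomplex {V : Type*} (L K : Complex V) : Prop :=
  ∃ W : Set V, L = induced K W

/-- The link of `σ` in `K`. -/
def link {V : Type*} [DecidableEq V] (K : Complex V) (σ : Finset V) : Complex V where
  carrier := {τ | τ ∈ K ∧ τ ∪ σ ∈ K ∧ τ ∩ σ = ∅}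
  lower' := fun _ _ hτ h =>
    ⟨K.lower hτ h.1, K.lower (Finset.union_subset_union_left hτ) h.2.1,
      Finset.subset_empty.1 (h.2.2 ▸ Finset.inter_subset_inter_right hτ)⟩

/-! ### Reduced simplicial homology -/

/-- The quotient `Z / B` of a submodule `Z` by a submodule `B` contained in it. -/
abbrev SubQuotient {R M : Type*} [Ring R] [AddCommGroup M] [Module R M] (Z B : Submodule R M) :
    Type _ :=
  Z ⧸ B.submoduleOf Z

section Homology

variable (𝕜 : Type*) [Field 𝕜] {V : Type*} [LinearOrder V]

/-- The simplicial boundary map on formal linear combinations of finite sets of vertices: for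
`σ = {v₀ < ⋯ < vₙ}` it is `∂σ = ∑ⱼ (-1)ʲ (σ \ {vⱼ})`. In particular `∂{v} = ∅` (the augmentation)
and `∂∅ = 0`. -/
noncomputable def boundary : (Finset V →₀ 𝕜) →ₗ[𝕜] (Finset V →₀ 𝕜) :=
  Finsupp.linearCombination 𝕜 fun σ : Finset V =>
    ∑ v ∈ σ, Finsupp.single (σ.erase v) ((-1 : 𝕜) ^ (σ.filter (· < v)).card)

/-- The space `C_i(K)` of `i`-chains: linear combinations of the `i`-dimensional faces of `K`
(the empty face has dimension `-1`). -/
def chains (K : Complex V) (i : ℤ) : Submodule 𝕜 (Finset V →₀ 𝕜) :=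
  Finsupp.supported 𝕜 𝕜 {σ : Finset V | σ ∈ K ∧ (σ.card : ℤ) = i + 1}

/-- The space of `i`-cycles, `ker (∂ : C_i(K) → C_{i-1}(K))`. -/
noncomputable def cycles (K : Complex V) (i : ℤ) : Submodule 𝕜 (Finset V →₀ 𝕜) :=
  chains 𝕜 K i ⊓ LinearMap.ker (boundary 𝕜)

/-- The space of `i`-boundaries, `im (∂ : C_{i+1}(K) → C_i(K))`. -/
noncomputable def boundaries (K : Complex V) (i : ℤ) : Submodule 𝕜 (Finset V →₀ 𝕜) :=
  (chains 𝕜 K (i + 1)).map (boundary 𝕜)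

/-- The reduced simplicial homology `H̃_i(K; 𝕜)`. -/
abbrev ReducedHomology (K : Complex V) (i : ℤ) : Type _ :=
  SubQuotient (cycles 𝕜 K i) (boundaries 𝕜 K i)

/-- `K` is acyclic over `𝕜`: all its reduced homology groups vanish. -/
def Acyclic (K : Complex V) : Prop :=
  ∀ i : ℤ, Subsingleton (ReducedHomology 𝕜 K i)

/-- `K` is `k`-fold acyclic over `𝕜`. -/
def FoldAcyclic (k : ℕ) (K : Complex V) : Prop :=
  ∀ σ ∈ K, σ.card < k → Acyclic 𝕜 (link K σ)

end Homology

/-! ### Boolean interval decompositions -/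

section Boolean

variable {P : Type*} [PartialOrder P]

/-- `I` is a rank `k` boolean interval of `P`: an interval `[x, y]` isomorphic to `2^[k]`. -/
def IsBooleanInterval (k : ℕ) (I : Set P) : Prop :=
  (∃ x y : P, I = Set.Icc x y) ∧ Nonempty (I ≃o Set (Fin k))

/-- `B` is a decomposition of `P` into disjoint rank `k` boolean intervals. -/
def IsBooleanDecomposition (k : ℕ) (B : Set (Set P)) : Prop :=
  (∀ I ∈ B, IsBooleanInterval k I) ∧ B.PairwiseDisjoint id ∧ ⋃₀ B = Set.univ

/-- The set of the minimal elements of the intervals in `B`. -/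
def minimalElements (B : Set (Set P)) : Set P :=
  {x | ∃ I ∈ B, IsLeast I x}

end Boolean

/-- Stanley's conjecture over the field `𝕜`: the face poset of every finite `k`-fold acyclic
simplicial complex decomposes into disjoint rank `k` boolean intervals, the minimal faces of which
form a subcomplex. -/
def StanleyConjecture (𝕜 : Type*) [Field 𝕜] : Prop :=
  ∀ (V : Type) [Fintype V] [LinearOrder V] (k : ℕ) (K : Complex V), FoldAcyclic 𝕜 k K →
    ∃ B : Set (Set K), IsBooleanDecomposition k B ∧
      ∃ L : Complex V, (L : Set (Finset V)) = Subtype.val '' minimalElements B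

/-! ### Simplicial balls -/

/-- The geometric realization of `K`: the points of the standard simplex on `V` (in barycentric
coordinates) whose support is a face of `K`. -/
def realization {V : Type*} [Fintype V] (K : Complex V) : Set (V → ℝ) :=
  {x | x ∈ stdSimplex ℝ V ∧ ∃ σ ∈ K, ∀ v, v ∈ σ ↔ x v ≠ 0}

/-- `K` is a simplicial `d`-ball: its geometric realization is homeomorphic to the closed unit ball
of `ℝᵈ`. -/
def IsSimplicialBall {V : Type*} [Fintype V] (d : ℕ) (K : Complex V) : Prop :=
  Nonempty (realization K ≃ₜ Metric.closedBall (0 : EuclideanSpace ℝ (Fin d)) 1)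

/-! ### Gluing copies of a complex along an induced subcomplex -/

section Gluing

variable {V : Type*} [LinearOrder V]

open Classical in
/-- The vertex map of the `i`-th copy: the vertices of `L` are shared by all copies, each other
vertex `v` gets its own copy `(i, v)`. The lexicographic orders only serve to order the vertices. -/
noncomputable def copyVertex (L : Complex V) (N : ℕ) (i : Fin N) (v : V) :
    V ⊕ₗ (Fin N ×ₗ V) :=
  if {v} ∈ L then Sum.inlₗ v else Sum.inrₗ (toLex (i, v))

/-- The complex obtained by gluing `N` copies of `K` together along its induced subcomplex `L`:
the union of the `N` copies of `K`, in which the copies of `L` are identified. -/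
noncomputable def glue (K L : Complex V) (N : ℕ) : Complex (V ⊕ₗ (Fin N ×ₗ V)) where
  carrier := {τ | ∃ i : Fin N, ∃ σ ∈ K, τ = σ.image (copyVertex L N i)}
  lower' := by
    rintro _ ρ hρ ⟨i, σ, hσ, rfl⟩
    obtain ⟨σ', hσ', rfl⟩ := Finset.subset_image_iff.1 hρ
    exact ⟨i, σ', K.lower (Finset.coe_subset.1 hσ') hσ, rfl⟩

end Gluing

/-! ### The complexes `Γ`, `Δ` and `Ω_N` -/

abbrev A : Fin 12 := 0
abbrev B : Fin 12 := 1
abbrev C : Fin 12 := 2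
abbrev D : Fin 12 := 3
abbrev E : Fin 12 := 4
abbrev F : Fin 12 := 5
abbrev G : Fin 12 := 6
abbrev H : Fin 12 := 7
abbrev I : Fin 12 := 8
abbrev J : Fin 12 := 9
abbrev K : Fin 12 := 10
abbrev L : Fin 12 := 11

def facetsΓ : Finset (Finset (Fin 12)) :=
  {{A, B, C, E}, {B, C, E, F}, {B, C, D, F}, {A, B, C, G}, {B, C, G, H}, {B, C, D, H},
   {A, B, E, G}, {B, E, F, G}, {B, F, H, G}}

/-- The facets of `Δ` that are not in `Γ`. -/
def otherFacetsΔ : Finset (Finset (Fin 12)) :=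
  {{A, B, C, J}, {A, B, I, J}, {B, C, I, J}, {B, C, D, I}, {C, D, I, J},
   {A, B, E, K}, {A, B, I, K}, {B, E, I, K}, {B, E, F, I}, {E, F, I, K},
   {A, B, G, L}, {A, B, I, L}, {B, G, I, L}, {B, G, H, I}, {G, H, I, L},
   {C, D, F, K}, {C, D, J, K}, {C, F, J, K}, {C, E, F, J}, {E, F, J, K},
   {C, D, H, L}, {C, D, J, L}, {C, H, J, L}, {C, G, H, J}, {G, H, J, L},
   {E, F, G, L}, {E, F, K, L}, {F, G, K, L}, {F, G, H, K}, {G, H, K, L}}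

def Γ : Complex (Fin 12) := generated (facetsΓ : Set (Finset (Fin 12)))

def Δ : Complex (Fin 12) := generated ((facetsΓ ∪ otherFacetsΔ : Finset (Finset (Fin 12))) :
  Set (Finset (Fin 12)))

/-- `N` copies of `Δ` glued together along `Γ`. -/
noncomputable def Ω (N : ℕ) : Complex (Fin 12 ⊕ₗ (Fin N ×ₗ Fin 12)) := glue Δ Γ N

end BoolDecomp

/-!
By Mayer–Vietoris, gluing copies of `Δ` along the induced subcomplex `Γ` preserves `2`-fold
acyclicity, since the links in the glued complex are copies of links of `Δ`, or unions of such
copies along a link of `Γ`. The complexes `Γ` and `Δ` and their vertex links are acyclic because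
their facets can be ordered so that each one meets the union of the earlier ones in a cone. The
ball `Γ` arises from the tetrahedron `BDFH` by four stellar subdivisions, at `DFH`, `CFH`, `CFG`
and `CEG`, with new vertices `C`, `G`, `E` and `A`.

Every rank `2` boolean interval of the face poset of `Δ` contains one of the `31` faces of `Γ` with
at most two vertices or one of `32` further faces outside `Γ`. A decomposition of `N` glued copies
therefore has at most `31 + 32 * N` intervals, which cover at most `124 + 128 * N` faces. As there
are `64 + 136 * N` faces, this is impossible for `N ≥ 8`.
-/

namespace BoolDecomp

section Complexes

variable {V W : Type*}

theorem mem_generated {S : Set (Finset V)} {σ : Finset V} :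
    σ ∈ generated S ↔ ∃ X ∈ S, σ ⊆ X :=
  mem_lowerClosure

theorem coe_generated [DecidableEq V] (S : Finset (Finset V)) :
    (generated (S : Set (Finset V)) : Set (Finset V)) = S.biUnion Finset.powerset := by
  ext σ
  simp [mem_generated]

theorem coe_generated_sdiff_generated [DecidableEq V] (S T : Finset (Finset V)) :
    (generated (S : Set (Finset V)) \ generated (T : Set (Finset V)) : Set (Finset V)) =
      S.biUnion fun X => {σ ∈ X.powerset | ∀ Y ∈ T, ¬ σ ⊆ Y} := by
  ext σ
  simp only [Set.mem_sdiff, SetLike.mem_coe, mem_generated, not_exists, not_and,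
    Finset.mem_biUnion, Finset.mem_filter, Finset.mem_powerset, ← and_assoc, exists_and_right]

theorem generated_le_generated {S T : Finset (Finset V)} :
    generated (S : Set (Finset V)) ≤ generated (T : Set (Finset V)) ↔
      ∀ X ∈ S, ∃ Y ∈ T, X ⊆ Y := by
  simp [generated, lowerClosure_le, Set.subset_def, mem_lowerClosure]

instance [DecidableEq V] {S T : Finset (Finset V)} :
    Decidable (generated (S : Set (Finset V)) ≤ generated (T : Set (Finset V))) :=
  decidable_of_iff' _ generated_le_generated

theorem singleton_mem_generated [DecidableEq V] {S : Finset (Finset V)} {v : V} :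
    {v} ∈ generated (S : Set (Finset V)) ↔ v ∈ S.biUnion id := by
  simp [mem_generated]

theorem hasDim_generated {S : Finset (Finset V)} (hS : S.Nonempty) :
    HasDim (generated (S : Set (Finset V))) (S.sup Finset.card - 1) := by
  constructor
  · obtain ⟨X, hX, hcard⟩ := Finset.exists_mem_eq_sup S hS Finset.card
    exact ⟨X, mem_generated.2 ⟨X, hX, subset_rfl⟩, by rw [hcard]⟩
  · rintro _ ⟨σ, hσ, rfl⟩
    obtain ⟨X, hX, hσX⟩ := mem_generated.1 hσ
    exact sub_le_sub_right
      (Nat.cast_le.2 ((Finset.card_le_card hσX).trans (Finset.le_sup hX))) 1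

/-- The image of a complex under a map of the vertices. -/
def mapComplex (f : V ↪ W) (M : Complex V) : Complex W where
  carrier := Finset.map f '' M
  lower' := by
    rintro _ ρ hρ ⟨σ, hσ, rfl⟩
    obtain ⟨σ', hσ', rfl⟩ := Finset.subset_map_iff.1 hρ
    exact ⟨σ', M.lower hσ' hσ, rfl⟩

theorem mem_mapComplex {f : V ↪ W} {M : Complex V} {τ : Finset W} :
    τ ∈ mapComplex f M ↔ ∃ σ ∈ M, σ.map f = τ := Iff.rfl

theorem map_mem_mapComplex {f : V ↪ W} {M : Complex V} {σ : Finset V} :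
    σ.map f ∈ mapComplex f M ↔ σ ∈ M :=
  (Finset.map_injective f).mem_set_image

theorem mem_sup_univ {ι : Type*} [Fintype ι] {M : ι → Complex V} {σ : Finset V} :
    σ ∈ Finset.univ.sup M ↔ ∃ i, σ ∈ M i := by
  rw [Finset.sup_univ_eq_iSup, LowerSet.mem_iSup_iff]

theorem IsInducedSubcomplex.le {M N : Complex V} (h : IsInducedSubcomplex M N) : M ≤ N := by
  obtain ⟨W, rfl⟩ := h
  exact fun _ hσ => hσ.1

theorem IsInducedSubcomplex.mem_iff {M N : Complex V} (h : IsInducedSubcomplex M N)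
    {σ : Finset V} (hσ : σ ∈ N) : σ ∈ M ↔ ∀ v ∈ σ, {v} ∈ M := by
  refine ⟨fun hM v hv => M.lower (Finset.singleton_subset_iff.2 hv) hM, fun hv => ?_⟩
  obtain ⟨W, rfl⟩ := h
  exact ⟨hσ, fun v hvσ => (hv v hvσ).2 (Finset.mem_singleton_self v)⟩

theorem induced_generated [DecidableEq V] (S : Finset (Finset V)) (W : Finset V) :
    induced (generated (S : Set (Finset V))) W =
      generated (S.image (· ∩ W) : Finset (Finset V)) := by
  ext σ
  change (σ ∈ generated (S : Set (Finset V)) ∧ (σ : Set V) ⊆ W) ↔ _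
  simp only [SetLike.mem_coe, mem_generated, Finset.mem_image, Finset.coe_subset]
  constructor
  · rintro ⟨⟨X, hX, hσX⟩, hσW⟩
    exact ⟨X ∩ W, ⟨X, hX, rfl⟩, Finset.subset_inter hσX hσW⟩
  · rintro ⟨_, ⟨X, hX, rfl⟩, hσ⟩
    obtain ⟨hσX, hσW⟩ := Finset.subset_inter_iff.1 hσ
    exact ⟨⟨X, hX, hσX⟩, hσW⟩

section Link

variable [DecidableEq V] [DecidableEq W]

theorem mem_link {M : Complex V} {σ τ : Finset V} :
    τ ∈ link M σ ↔ τ ∪ σ ∈ M ∧ τ ∩ σ = ∅ :=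
  ⟨fun h => ⟨h.2.1, h.2.2⟩, fun h => ⟨M.lower Finset.subset_union_left h.1, h⟩⟩

theorem link_empty (M : Complex V) : link M ∅ = M := by
  ext τ
  simp [mem_link]

theorem link_mapComplex (f : V ↪ W) (M : Complex V) (σ : Finset V) :
    link (mapComplex f M) (σ.map f) = mapComplex f (link M σ) := by
  have hmap (τ : Finset V) :
      τ.map f ∈ link (mapComplex f M) (σ.map f) ↔ τ ∈ link M σ := by
    rw [mem_link, ← Finset.map_union, map_mem_mapComplex, ← Finset.map_inter,
      Finset.map_eq_empty, mem_link]
  ext τ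
  constructor
  · intro h
    obtain ⟨τ, -, rfl⟩ := h.1
    exact ⟨τ, (hmap τ).1 h, rfl⟩
  · rintro ⟨τ, hτ, rfl⟩
    exact (hmap τ).2 hτ

theorem link_inf (M N : Complex V) (σ : Finset V) :
    link (M ⊓ N) σ = link M σ ⊓ link N σ := by
  ext τ
  simp only [SetLike.mem_coe, LowerSet.mem_inf_iff, mem_link]
  tauto

theorem link_sup_univ {ι : Type*} [Fintype ι] (M : ι → Complex V) (σ : Finset V) :
    link (Finset.univ.sup M) σ = Finset.univ.sup fun i => link (M i) σ := by
  ext τ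
  simp only [SetLike.mem_coe, mem_sup_univ, mem_link, exists_and_right]

theorem link_generated_singleton (S : Finset (Finset V)) (v : V) :
    link (generated (S : Set (Finset V))) {v} =
      generated ({X ∈ S | v ∈ X}.image (Finset.erase · v) : Finset (Finset V)) := by
  ext τ
  simp only [SetLike.mem_coe, mem_link, mem_generated, ← Finset.disjoint_iff_inter_eq_empty,
    Finset.disjoint_singleton_right, Finset.mem_image, Finset.mem_filter,
    Finset.union_singleton, Finset.insert_subset_iff]
  constructor
  · rintro ⟨⟨X, hX, hvX, hτX⟩, hv⟩
    exact ⟨X.erase v, ⟨X, ⟨hX, hvX⟩, rfl⟩, Finset.subset_erase.2 ⟨hτX, hv⟩⟩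
  · rintro ⟨_, ⟨X, ⟨hX, hvX⟩, rfl⟩, hτX⟩
    obtain ⟨hτX, hv⟩ := Finset.subset_erase.1 hτX
    exact ⟨⟨X, hX, hvX, hτX⟩, hv⟩

end Link

end Complexes

section Chains

variable (𝕜 : Type*) [Field 𝕜] {V W : Type*} {M N : Complex V} {i : ℤ}

theorem single_mem_chains {σ : Finset V} (hσ : σ ∈ M) (hi : (σ.card : ℤ) = i + 1) (c : 𝕜) :
    Finsupp.single σ c ∈ chains 𝕜 M i :=
  Finsupp.single_mem_supported 𝕜 c ⟨hσ, hi⟩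

theorem chains_le_comap {j : ℤ} {f : (Finset V →₀ 𝕜) →ₗ[𝕜] (Finset V →₀ 𝕜)}
    (hf : ∀ σ ∈ M, (σ.card : ℤ) = i + 1 → f (Finsupp.single σ 1) ∈ chains 𝕜 N j) :
    chains 𝕜 M i ≤ (chains 𝕜 N j).comap f := by
  rw [chains, Finsupp.supported_eq_span_single, Submodule.span_le]
  rintro _ ⟨σ, hσ, rfl⟩
  exact hf σ hσ.1 hσ.2

theorem chains_bot (i : ℤ) : chains 𝕜 (⊥ : Complex V) i = ⊥ := by
  rw [chains, ← Finsupp.supported_empty]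
  congr 1
  exact Set.eq_empty_of_forall_notMem fun _ hσ => hσ.1

theorem chains_sup (M N : Complex V) (i : ℤ) :
    chains 𝕜 (M ⊔ N) i = chains 𝕜 M i ⊔ chains 𝕜 N i := by
  rw [chains, chains, chains, ← Finsupp.supported_union]
  congr 1
  ext σ
  exact or_and_right

theorem chains_inf (M N : Complex V) (i : ℤ) :
    chains 𝕜 (M ⊓ N) i = chains 𝕜 M i ⊓ chains 𝕜 N i := by
  rw [chains, chains, chains, ← Finsupp.supported_inter]
  congr 1
  ext σ
  exact and_and_right

theorem chains_mapComplex (f : V ↪ W) (M : Complex V) (i : ℤ) :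
    chains 𝕜 (mapComplex f M) i =
      (chains 𝕜 M i).map (Finsupp.lmapDomain 𝕜 𝕜 (Finset.map f)) := by
  rw [chains, chains, Finsupp.lmapDomain_supported]
  congr 1
  ext τ
  constructor
  · rintro ⟨⟨σ, hσ, rfl⟩, hi⟩
    exact ⟨σ, ⟨hσ, by rwa [Finset.card_map] at hi⟩, rfl⟩
  · rintro ⟨σ, ⟨hσ, hi⟩, rfl⟩
    exact ⟨⟨σ, hσ, rfl⟩, by rwa [Finset.card_map]⟩

end Chains

section Homology

variable (𝕜 : Type*) [Field 𝕜] {V : Type*} [LinearOrder V]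

/-- The sign with which `σ \ {v}` occurs in the boundary of `σ`. It is also defined for `v ∉ σ`,
where it is the sign of `σ` in the boundary of `σ ∪ {v}`. -/
def vertexSign (σ : Finset V) (v : V) : 𝕜 := (-1 : 𝕜) ^ (σ.filter (· < v)).card

theorem vertexSign_mul_self (σ : Finset V) (v : V) :
    vertexSign 𝕜 σ v * vertexSign 𝕜 σ v = 1 := by
  rw [vertexSign, ← mul_pow, neg_one_mul, neg_neg, one_pow]

theorem vertexSign_insert_self (σ : Finset V) (v : V) :
    vertexSign 𝕜 (insert v σ) v = vertexSign 𝕜 σ v := by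
  rw [vertexSign, Finset.filter_insert, if_neg (lt_irrefl v), vertexSign]

theorem vertexSign_erase_self {σ : Finset V} {v : V} (hv : v ∈ σ) :
    vertexSign 𝕜 (σ.erase v) v = vertexSign 𝕜 σ v := by
  rw [← vertexSign_insert_self, Finset.insert_erase hv]

theorem vertexSign_mul_vertexSign_insert {σ : Finset V} {u v : V} (hv : v ∉ σ) (hu : u ∈ σ) :
    vertexSign 𝕜 σ v * vertexSign 𝕜 (insert v σ) u =
      -(vertexSign 𝕜 σ u * vertexSign 𝕜 (σ.erase u) v) := by
  obtain ⟨ρ, hρ, rfl⟩ : ∃ ρ, u ∉ ρ ∧ σ = insert u ρ :=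
    ⟨σ.erase u, Finset.notMem_erase u σ, (Finset.insert_erase hu).symm⟩
  obtain ⟨hvu, hvρ⟩ : v ≠ u ∧ v ∉ ρ := by simpa using hv
  rw [Finset.erase_insert hρ]
  simp only [vertexSign, Finset.filter_insert, lt_irrefl, if_false]
  rcases lt_or_gt_of_ne hvu with h | h
  · rw [if_neg h.not_gt, if_pos h, Finset.card_insert_of_notMem (by simp [hvρ])]
    ring
  · rw [if_pos h, if_neg h.not_gt, Finset.card_insert_of_notMem (by simp [hρ])]
    ring

theorem boundary_single (σ : Finset V) :
    boundary 𝕜 (Finsupp.single σ 1) =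
      ∑ v ∈ σ, Finsupp.single (σ.erase v) (vertexSign 𝕜 σ v) := by
  simp [boundary, vertexSign]

/-- The cone operator with apex `v`, which sends `σ` to `± (σ ∪ {v})` if `v ∉ σ` and to `0` if
`v ∈ σ`. It is a contracting homotopy of the chain complex of a cone with apex `v`. -/
noncomputable def coneMap (v : V) : (Finset V →₀ 𝕜) →ₗ[𝕜] (Finset V →₀ 𝕜) :=
  Finsupp.linearCombination 𝕜 fun σ : Finset V =>
    if v ∈ σ then 0 else Finsupp.single (insert v σ) (vertexSign 𝕜 σ v)

theorem coneMap_single_of_mem {v : V} {σ : Finset V} (h : v ∈ σ) (c : 𝕜) :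
    coneMap 𝕜 v (Finsupp.single σ c) = 0 := by
  simp [coneMap, h]

theorem coneMap_single_of_notMem {v : V} {σ : Finset V} (h : v ∉ σ) (c : 𝕜) :
    coneMap 𝕜 v (Finsupp.single σ c) = Finsupp.single (insert v σ) (c * vertexSign 𝕜 σ v) := by
  simp [coneMap, h]

theorem coneMap_boundary_single_of_mem {v : V} {σ : Finset V} (hv : v ∈ σ) :
    coneMap 𝕜 v (boundary 𝕜 (Finsupp.single σ 1)) = Finsupp.single σ 1 := by
  rw [boundary_single, map_sum, Finset.sum_eq_single_of_mem v hv]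
  · rw [coneMap_single_of_notMem 𝕜 (Finset.notMem_erase v σ), Finset.insert_erase hv,
      vertexSign_erase_self 𝕜 hv, vertexSign_mul_self]
  · exact fun u _ huv => coneMap_single_of_mem 𝕜 (Finset.mem_erase.2 ⟨huv.symm, hv⟩) _

theorem boundary_coneMap_single_of_notMem {v : V} {σ : Finset V} (hv : v ∉ σ) :
    boundary 𝕜 (coneMap 𝕜 v (Finsupp.single σ 1)) =
      Finsupp.single σ 1 - coneMap 𝕜 v (boundary 𝕜 (Finsupp.single σ 1)) := by
  rw [coneMap_single_of_notMem 𝕜 hv, one_mul, ← mul_one (vertexSign 𝕜 σ v), ← smul_eq_mul,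
    ← Finsupp.smul_single, map_smul, boundary_single, Finset.sum_insert hv,
    Finset.erase_insert hv, smul_add, vertexSign_insert_self, Finsupp.smul_single, smul_eq_mul,
    vertexSign_mul_self, sub_eq_add_neg, boundary_single, map_sum, Finset.smul_sum,
    ← Finset.sum_neg_distrib]
  refine congrArg _ (Finset.sum_congr rfl fun u hu => ?_)
  rw [coneMap_single_of_notMem 𝕜 (fun h => hv (Finset.mem_of_mem_erase h)), Finsupp.smul_single,
    smul_eq_mul, vertexSign_mul_vertexSign_insert 𝕜 hv hu,
    Finset.erase_insert_of_ne (ne_of_mem_of_not_mem hu hv).symm, Finsupp.single_neg]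

theorem boundary_coneMap_add (v : V) (z : Finset V →₀ 𝕜) :
    boundary 𝕜 (coneMap 𝕜 v z) + coneMap 𝕜 v (boundary 𝕜 z) = z := by
  suffices boundary 𝕜 ∘ₗ coneMap 𝕜 v + coneMap 𝕜 v ∘ₗ boundary 𝕜 = LinearMap.id from
    LinearMap.congr_fun this z
  refine Finsupp.lhom_ext' fun σ => LinearMap.ext_ring ?_
  simp only [LinearMap.comp_apply, LinearMap.add_apply, Finsupp.lsingle_apply, LinearMap.id_apply]
  by_cases hv : v ∈ σ
  · rw [coneMap_single_of_mem 𝕜 hv, map_zero, zero_add, coneMap_boundary_single_of_mem 𝕜 hv]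
  · rw [boundary_coneMap_single_of_notMem 𝕜 hv, sub_add_cancel]

/-- By induction on `σ`, writing `σ ∪ {v}` as a multiple of the cone over `σ`. -/
theorem boundary_boundary_single (σ : Finset V) :
    boundary 𝕜 (boundary 𝕜 (Finsupp.single σ 1)) = 0 := by
  induction σ using Finset.induction_on with
  | empty => simp [boundary_single]
  | insert v τ hv ih =>
    have hcone : Finsupp.single (insert v τ) 1 =
        vertexSign 𝕜 τ v • coneMap 𝕜 v (Finsupp.single τ 1) := by
      rw [coneMap_single_of_notMem 𝕜 hv, Finsupp.smul_single, one_mul, smul_eq_mul,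
        vertexSign_mul_self]
    have hτ := boundary_coneMap_add 𝕜 v (boundary 𝕜 (Finsupp.single τ 1))
    rw [ih, map_zero, add_zero] at hτ
    rw [hcone, map_smul, map_smul, boundary_coneMap_single_of_notMem 𝕜 hv, map_sub, hτ, sub_self,
      smul_zero]

theorem boundary_boundary (z : Finset V →₀ 𝕜) : boundary 𝕜 (boundary 𝕜 z) = 0 := by
  suffices boundary 𝕜 ∘ₗ boundary 𝕜 = (0 : (Finset V →₀ 𝕜) →ₗ[𝕜] _) from
    LinearMap.congr_fun this z
  exact Finsupp.lhom_ext' fun σ => LinearMap.ext_ring (boundary_boundary_single 𝕜 σ)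

theorem chains_le_comap_boundary (M : Complex V) (i : ℤ) :
    chains 𝕜 M (i + 1) ≤ (chains 𝕜 M i).comap (boundary 𝕜) := by
  refine chains_le_comap 𝕜 fun σ hσ hi => ?_
  rw [boundary_single]
  refine Submodule.sum_mem _ fun v hv => single_mem_chains 𝕜 (M.lower (σ.erase_subset v) hσ) ?_ _
  have := Finset.card_erase_add_one hv
  omega

theorem chains_le_comap_coneMap {M : Complex V} {v : V} (h : ∀ σ ∈ M, insert v σ ∈ M) (i : ℤ) :
    chains 𝕜 M i ≤ (chains 𝕜 M (i + 1)).comap (coneMap 𝕜 v) := by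
  refine chains_le_comap 𝕜 fun σ hσ hi => ?_
  by_cases hv : v ∈ σ
  · rw [coneMap_single_of_mem 𝕜 hv]
    exact Submodule.zero_mem _
  · rw [coneMap_single_of_notMem 𝕜 hv]
    refine single_mem_chains 𝕜 (h σ hσ) ?_ _
    rw [Finset.card_insert_of_notMem hv]
    omega

theorem boundary_lmapDomain {W : Type*} [LinearOrder W] {f : V ↪ W} (hf : StrictMono f)
    (z : Finset V →₀ 𝕜) :
    boundary 𝕜 (Finsupp.lmapDomain 𝕜 𝕜 (Finset.map f) z) =
      Finsupp.lmapDomain 𝕜 𝕜 (Finset.map f) (boundary 𝕜 z) := by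
  suffices boundary 𝕜 ∘ₗ Finsupp.lmapDomain 𝕜 𝕜 (Finset.map f) =
      Finsupp.lmapDomain 𝕜 𝕜 (Finset.map f) ∘ₗ boundary 𝕜 from LinearMap.congr_fun this z
  have hsign (σ : Finset V) (v : V) : vertexSign 𝕜 (σ.map f) (f v) = vertexSign 𝕜 σ v := by
    simp only [vertexSign, Finset.filter_map, Finset.card_map, Function.comp_def, hf.lt_iff_lt]
  refine Finsupp.lhom_ext' fun σ => LinearMap.ext_ring ?_
  simp only [LinearMap.comp_apply, Finsupp.lsingle_apply, Finsupp.lmapDomain_apply,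
    Finsupp.mapDomain_single, boundary_single, Finset.sum_map, hsign, Finsupp.mapDomain_finsetSum,
    Finset.map_erase]

theorem acyclic_iff {M : Complex V} :
    Acyclic 𝕜 M ↔ ∀ i : ℤ, ∀ z ∈ chains 𝕜 M i, boundary 𝕜 z = 0 →
      ∃ w ∈ chains 𝕜 M (i + 1), boundary 𝕜 w = z := by
  refine forall_congr' fun i => Submodule.Quotient.subsingleton_iff.trans ?_
  rw [Submodule.submoduleOf_eq_top]
  simp only [SetLike.le_def, cycles, boundaries, Submodule.mem_inf, Submodule.mem_map,
    LinearMap.mem_ker, and_imp]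

theorem acyclic_bot : Acyclic 𝕜 (⊥ : Complex V) := by
  refine (acyclic_iff 𝕜).2 fun i z hz _ => ⟨0, Submodule.zero_mem _, ?_⟩
  rw [chains_bot, Submodule.mem_bot] at hz
  rw [hz, map_zero]

theorem acyclic_of_forall_insert_mem {M : Complex V} (v : V) (h : ∀ σ ∈ M, insert v σ ∈ M) :
    Acyclic 𝕜 M := by
  refine (acyclic_iff 𝕜).2 fun i z hz hdz => ⟨_, chains_le_comap_coneMap 𝕜 h i hz, ?_⟩
  simpa only [hdz, map_zero, add_zero] using boundary_coneMap_add 𝕜 v z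

variable {𝕜}

theorem Acyclic.mapComplex {W : Type*} [LinearOrder W] {M : Complex V} (hM : Acyclic 𝕜 M)
    {f : V ↪ W} (hf : StrictMono f) : Acyclic 𝕜 (mapComplex f M) := by
  refine (acyclic_iff 𝕜).2 fun i z hz hdz => ?_
  simp only [chains_mapComplex] at hz ⊢
  obtain ⟨y, hy, rfl⟩ := hz
  have hinj : Function.Injective (Finsupp.lmapDomain 𝕜 𝕜 (Finset.map f)) :=
    Finsupp.mapDomain_injective (Finset.map_injective f)
  rw [boundary_lmapDomain 𝕜 hf] at hdz
  obtain ⟨w, hw, rfl⟩ := (acyclic_iff 𝕜).1 hM i y hy (hinj (hdz.trans (map_zero _).symm))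
  exact ⟨_, Submodule.mem_map_of_mem hw, boundary_lmapDomain 𝕜 hf w⟩

/-- The Mayer–Vietoris argument: split a cycle as `a + b` with `a` in `M` and `b` in `N`; then
`∂a = -∂b` lies in `M ⊓ N`, hence is `∂w` there, and `a - w` and `b + w` are cycles. -/
theorem Acyclic.sup {M N : Complex V} (hM : Acyclic 𝕜 M) (hN : Acyclic 𝕜 N)
    (hMN : Acyclic 𝕜 (M ⊓ N)) : Acyclic 𝕜 (M ⊔ N) := by
  rw [acyclic_iff] at *
  intro i z hz hdz
  rw [chains_sup] at hz ⊢
  obtain ⟨a, ha, b, hb, rfl⟩ := Submodule.mem_sup.1 hz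
  obtain ⟨j, rfl⟩ : ∃ j, i = j + 1 := ⟨i - 1, (sub_add_cancel i 1).symm⟩
  have hab : boundary 𝕜 a = -boundary 𝕜 b := eq_neg_of_add_eq_zero_left (by rw [← map_add, hdz])
  have hda : boundary 𝕜 a ∈ chains 𝕜 (M ⊓ N) j := by
    rw [chains_inf]
    refine ⟨chains_le_comap_boundary 𝕜 M j ha, ?_⟩
    rw [hab]
    exact Submodule.neg_mem _ (chains_le_comap_boundary 𝕜 N j hb)
  obtain ⟨w, hw, hdw⟩ := hMN j _ hda (boundary_boundary 𝕜 a)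
  rw [chains_inf] at hw
  obtain ⟨p, hp, hdp⟩ := hM (j + 1) (a - w) (Submodule.sub_mem _ ha hw.1)
    (by rw [map_sub, hdw, sub_self])
  obtain ⟨q, hq, hdq⟩ := hN (j + 1) (b + w) (Submodule.add_mem _ hb hw.2)
    (by rw [map_add, hdw, hab, add_neg_cancel])
  refine ⟨p + q, Submodule.add_mem_sup hp hq, ?_⟩
  rw [map_add, hdp, hdq]
  abel

theorem Acyclic.finset_sup {ι : Type*} {M : ι → Complex V} {N : Complex V}
    (hN : Acyclic 𝕜 N) (hM : ∀ i, Acyclic 𝕜 (M i)) (hMN : Pairwise fun i j => M i ⊓ M j = N)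
    {s : Finset ι} (hs : s.Nonempty) : Acyclic 𝕜 (s.sup M) := by
  induction hs using Finset.Nonempty.cons_induction with
  | singleton i => simpa only [Finset.sup_singleton] using hM i
  | cons i s hi hs ih =>
    rw [Finset.sup_cons]
    refine (hM i).sup ih ?_
    have hinf : M i ⊓ s.sup M = s.sup fun _ => N := by
      rw [Finset.sup_inf_distrib_left]
      exact Finset.sup_congr rfl fun j hj => hMN (ne_of_mem_of_not_mem hj hi).symm
    rwa [hinf, Finset.sup_const hs]

theorem foldAcyclic_two_iff {M : Complex V} :
    FoldAcyclic 𝕜 2 M ↔ (∅ ∈ M → Acyclic 𝕜 M) ∧ ∀ v, {v} ∈ M → Acyclic 𝕜 (link M {v}) := by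
  constructor
  · intro h
    exact ⟨fun h₀ => link_empty M ▸ h ∅ h₀ (by simp), fun v hv => h {v} hv (by simp)⟩
  · rintro ⟨h₀, h₁⟩ σ hσ hcard
    obtain hσ₀ | hσ₁ : σ.card = 0 ∨ σ.card = 1 := by omega
    · obtain rfl := Finset.card_eq_zero.1 hσ₀
      exact (link_empty M).symm ▸ h₀ hσ
    · obtain ⟨v, rfl⟩ := Finset.card_eq_one.1 hσ₁
      exact h₁ v hσ

end Homology

section AcyclicOrder

variable {V : Type*}

section Decidable

variable [DecidableEq V]

/-- An ordering of the facets of a complex, listed from the last to the first, in which every facet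
meets the complex generated by the earlier ones in a cone. -/
def IsAcyclicOrder : List (Finset V) → Prop
  | [] => True
  | X :: l => (∃ v ∈ X, ∀ Y ∈ l, ∃ Z ∈ l, insert v (Y ∩ X) ⊆ Z) ∧ IsAcyclicOrder l

instance IsAcyclicOrder.decidable : ∀ l : List (Finset V), Decidable (IsAcyclicOrder l)
  | [] => inferInstanceAs (Decidable True)
  | X :: l =>
    have := IsAcyclicOrder.decidable l
    inferInstanceAs (Decidable ((∃ v ∈ X, ∀ Y ∈ l, ∃ Z ∈ l, insert v (Y ∩ X) ⊆ Z) ∧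
      IsAcyclicOrder l))

end Decidable

variable (𝕜 : Type*) [Field 𝕜] [LinearOrder V]

theorem acyclic_generated_of_isAcyclicOrder {l : List (Finset V)} (h : IsAcyclicOrder l) :
    Acyclic 𝕜 (generated (l.toFinset : Set (Finset V))) := by
  induction l with
  | nil =>
    rw [generated, List.toFinset_nil, Finset.coe_empty, lowerClosure_empty]
    exact acyclic_bot 𝕜
  | cons X l ih =>
    obtain ⟨⟨v, hvX, hv⟩, hl⟩ := h
    rw [generated, List.toFinset_cons, Finset.coe_insert, Set.insert_eq, lowerClosure_union]
    refine Acyclic.sup (acyclic_of_forall_insert_mem 𝕜 v fun σ hσ => ?_) (ih hl)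
      (acyclic_of_forall_insert_mem 𝕜 v fun σ hσ => ?_)
    all_goals
      simp only [LowerSet.mem_inf_iff, mem_lowerClosure, Set.mem_singleton_iff, exists_eq_left,
        Finset.mem_coe, List.mem_toFinset] at hσ ⊢
    · exact Finset.insert_subset hvX hσ
    · obtain ⟨hσX, Y, hY, hσY⟩ := hσ
      obtain ⟨Z, hZ, hYZ⟩ := hv Y hY
      exact ⟨Finset.insert_subset hvX hσX, Z, hZ,
        (Finset.insert_subset_insert v (Finset.subset_inter hσY hσX)).trans hYZ⟩

theorem foldAcyclic_two_generated {S : Finset (Finset V)} {l : List (Finset V)}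
    {linkOrder : V → List (Finset V)} (hS : l.toFinset = S) (hl : IsAcyclicOrder l)
    (hlink : ∀ v, (linkOrder v).toFinset = {X ∈ S | v ∈ X}.image (Finset.erase · v))
    (hlinkOrder : ∀ v, IsAcyclicOrder (linkOrder v)) :
    FoldAcyclic 𝕜 2 (generated (S : Set (Finset V))) := by
  refine foldAcyclic_two_iff.2 ⟨fun _ => ?_, fun v _ => ?_⟩
  · rw [← hS]
    exact acyclic_generated_of_isAcyclicOrder 𝕜 hl
  · rw [link_generated_singleton, ← hlink]
    exact acyclic_generated_of_isAcyclicOrder 𝕜 (hlinkOrder v)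

end AcyclicOrder

section Gluing

variable {V : Type*} {K L : Complex V} {N : ℕ}

theorem copyVertex_eq_iff {i j : Fin N} {u v : V} :
    copyVertex L N i u = copyVertex L N j v ↔ u = v ∧ ({v} ∈ L ∨ i = j) := by
  unfold copyVertex
  split_ifs with hu hv hv
  · rw [Sum.inlₗ, Sum.inlₗ, toLex_inj, Sum.inl.injEq]
    simp [hv]
  · rw [Sum.inlₗ, Sum.inrₗ, toLex_inj]
    grind
  · rw [Sum.inlₗ, Sum.inrₗ, toLex_inj]
    grind
  · rw [Sum.inrₗ, Sum.inrₗ, toLex_inj, Sum.inr.injEq, toLex_inj, Prod.mk.injEq]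
    simp [hv, and_comm]

variable (L) in
/-- `copyVertex` as an embedding. -/
noncomputable def copyEmb (i : Fin N) : V ↪ V ⊕ₗ (Fin N ×ₗ V) :=
  ⟨copyVertex L N i, fun _ _ h => (copyVertex_eq_iff.1 h).1⟩

theorem map_copyEmb_eq_of_mem {σ : Finset V} (hσ : σ ∈ L) (i j : Fin N) :
    σ.map (copyEmb L i) = σ.map (copyEmb L j) := by
  classical
  rw [Finset.map_eq_image, Finset.map_eq_image]
  exact Finset.image_congr fun v hv => copyVertex_eq_iff.2
    ⟨rfl, Or.inl (L.lower (Finset.singleton_subset_iff.2 hv) hσ)⟩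

theorem eq_of_map_copyEmb_subset (hL : IsInducedSubcomplex L K) {i j : Fin N} {σ τ : Finset V}
    (hσ : σ ∈ K) (hσL : σ ∉ L) (h : σ.map (copyEmb L i) ⊆ τ.map (copyEmb L j)) : i = j := by
  obtain ⟨v, hvσ, hv⟩ : ∃ v ∈ σ, {v} ∉ L := by
    by_contra! hv
    exact hσL ((hL.mem_iff hσ).2 hv)
  obtain ⟨u, -, huv⟩ := Finset.mem_map.1 (h (Finset.mem_map_of_mem _ hvσ))
  exact ((copyVertex_eq_iff.1 huv).2.resolve_left hv).symm

theorem mapComplex_copyEmb_inf (hL : IsInducedSubcomplex L K) {i j : Fin N} (hij : i ≠ j)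
    (k : Fin N) :
    mapComplex (copyEmb L i) K ⊓ mapComplex (copyEmb L j) K = mapComplex (copyEmb L k) L := by
  ext τ
  constructor
  · rintro ⟨⟨σ, hσ, rfl⟩, ⟨ρ, -, h⟩⟩
    have hσL : σ ∈ L := by
      by_contra hσL
      exact hij (eq_of_map_copyEmb_subset hL hσ hσL h.ge)
    exact ⟨σ, hσL, map_copyEmb_eq_of_mem hσL k i⟩
  · rintro ⟨σ, hσ, rfl⟩
    exact ⟨⟨σ, hL.le hσ, map_copyEmb_eq_of_mem hσ i k⟩, ⟨σ, hL.le hσ, map_copyEmb_eq_of_mem hσ j k⟩⟩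

theorem mapComplex_copyEmb_link_inf [DecidableEq V] (hL : IsInducedSubcomplex L K) {σ : Finset V}
    (hσ : σ ∈ L) {i j : Fin N} (hij : i ≠ j) (k : Fin N) :
    mapComplex (copyEmb L i) (link K σ) ⊓ mapComplex (copyEmb L j) (link K σ) =
      mapComplex (copyEmb L k) (link L σ) := by
  classical
  rw [← link_mapComplex, ← link_mapComplex, ← link_mapComplex, map_copyEmb_eq_of_mem hσ i k,
    map_copyEmb_eq_of_mem hσ j k, ← link_inf, mapComplex_copyEmb_inf hL hij k]

variable [LinearOrder V]

theorem copyVertex_strictMono (hL : IsLowerSet {v | {v} ∈ L}) (i : Fin N) :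
    StrictMono (copyVertex L N i) := by
  intro u v huv
  unfold copyVertex
  split_ifs with hu hv hv
  · exact Sum.Lex.inl_lt_inl_iff.2 huv
  · exact Sum.Lex.inl_lt_inr _ _
  · exact absurd (hL huv.le hv) hu
  · exact Sum.Lex.inr_lt_inr_iff.2 (Prod.Lex.lt_iff.2 (Or.inr ⟨rfl, huv⟩))

theorem mem_glue {τ : Finset (V ⊕ₗ (Fin N ×ₗ V))} :
    τ ∈ glue K L N ↔ ∃ i, τ ∈ mapComplex (copyEmb L i) K := by
  simp only [mem_mapComplex, Finset.map_eq_image, eq_comm (b := τ)]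
  rfl

theorem glue_eq_sup : glue K L N = Finset.univ.sup fun i => mapComplex (copyEmb L i) K := by
  ext τ
  rw [SetLike.mem_coe, SetLike.mem_coe, mem_sup_univ, mem_glue]

theorem HasDim.glue {d : ℤ} (hK : HasDim K d) (hN : 0 < N) : HasDim (glue K L N) d := by
  have hdim : {n : ℤ | ∃ τ ∈ BoolDecomp.glue K L N, n = (τ.card : ℤ) - 1} =
      {n : ℤ | ∃ σ ∈ K, n = (σ.card : ℤ) - 1} := by
    ext n
    constructor
    · rintro ⟨τ, hτ, rfl⟩
      obtain ⟨i, σ, hσ, rfl⟩ := mem_glue.1 hτ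
      exact ⟨σ, hσ, by rw [Finset.card_map]⟩
    · rintro ⟨σ, hσ, rfl⟩
      exact ⟨_, mem_glue.2 ⟨⟨0, hN⟩, σ, hσ, rfl⟩, by rw [Finset.card_map]⟩
  rwa [HasDim, hdim]

theorem link_glue_of_notMem [DecidableEq (V ⊕ₗ (Fin N ×ₗ V))] (hL : IsInducedSubcomplex L K)
    {σ : Finset V} (hσ : σ ∈ K) (hσL : σ ∉ L) (i : Fin N) :
    link (glue K L N) (σ.map (copyEmb L i)) = mapComplex (copyEmb L i) (link K σ) := by
  rw [← link_mapComplex]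
  ext τ
  simp only [SetLike.mem_coe, mem_link, mem_glue]
  refine and_congr_left fun _ => ⟨?_, fun h => ⟨i, h⟩⟩
  rintro ⟨j, ρ, hρ, h⟩
  obtain rfl := eq_of_map_copyEmb_subset hL hσ hσL (Finset.subset_union_right.trans h.ge)
  exact ⟨ρ, hρ, h⟩

theorem link_glue_of_mem [DecidableEq (V ⊕ₗ (Fin N ×ₗ V))] {σ : Finset V} (hσL : σ ∈ L)
    (i : Fin N) :
    link (glue K L N) (σ.map (copyEmb L i)) =
      Finset.univ.sup fun j => mapComplex (copyEmb L j) (link K σ) := by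
  rw [glue_eq_sup, link_sup_univ]
  refine Finset.sup_congr rfl fun j _ => ?_
  rw [map_copyEmb_eq_of_mem hσL i j, link_mapComplex]

theorem FoldAcyclic.glue {𝕜 : Type*} [Field 𝕜] {k : ℕ} (hK : FoldAcyclic 𝕜 k K)
    (hL : FoldAcyclic 𝕜 k L) (hLK : IsInducedSubcomplex L K) (hlower : IsLowerSet {v | {v} ∈ L})
    (N : ℕ) : FoldAcyclic 𝕜 k (glue K L N) := by
  intro τ hτ hcard
  obtain ⟨i, σ, hσ, rfl⟩ := mem_glue.1 hτ
  rw [Finset.card_map] at hcard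
  have hcopy (j : Fin N) : Acyclic 𝕜 (mapComplex (copyEmb L j) (link K σ)) :=
    (hK σ hσ hcard).mapComplex (copyVertex_strictMono hlower j)
  by_cases hσL : σ ∈ L
  · refine (congrArg (Acyclic 𝕜) (link_glue_of_mem hσL i)).mpr ?_
    exact Acyclic.finset_sup ((hL σ hσL hcard).mapComplex (copyVertex_strictMono hlower i)) hcopy
      (fun j k hjk => mapComplex_copyEmb_link_inf hLK hσL hjk i) ⟨i, Finset.mem_univ i⟩
  · exact (congrArg (Acyclic 𝕜) (link_glue_of_notMem hLK hσ hσL i)).mpr (hcopy i)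

end Gluing

section BooleanIntervals

theorem IsBooleanInterval.ncard_eq {P : Type*} [PartialOrder P] {k : ℕ} {I : Set P}
    (hI : IsBooleanInterval k I) : I.ncard = 2 ^ k := by
  obtain ⟨-, ⟨e⟩⟩ := hI
  rw [← Nat.card_coe_set_eq, Nat.card_congr e.toEquiv, Nat.card_eq_fintype_card, Fintype.card_set,
    Fintype.card_fin]

theorem IsBooleanDecomposition.card_le {P : Type*} [PartialOrder P] {k : ℕ} {B : Set (Set P)}
    (hB : IsBooleanDecomposition k B) {T : Finset P} (hT : ∀ I ∈ B, ∃ t ∈ T, t ∈ I) :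
    Nat.card P ≤ 2 ^ k * T.card := by
  obtain ⟨hinterval, hdisj, hunion⟩ := hB
  have hcover (p : P) : ∃ I ∈ B, p ∈ I := by
    rw [← Set.mem_sUnion, hunion]
    exact Set.mem_univ p
  choose J hJ hpJ using hcover
  have huniv : Set.univ = ⋃ t ∈ T, J t := by
    refine (Set.eq_univ_of_forall fun p => ?_).symm
    obtain ⟨t, ht, htp⟩ := hT (J p) (hJ p)
    have hJt : J t = J p := hdisj.elim_set (hJ t) (hJ p) t (hpJ t) htp
    exact Set.mem_biUnion ht (hJt ▸ hpJ p)
  calc Nat.card P = (⋃ t ∈ T, J t).ncard := by rw [← huniv, Set.ncard_univ]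
    _ ≤ ∑ t ∈ T, (J t).ncard := Finset.set_ncard_biUnion_le T J
    _ = ∑ _t ∈ T, 2 ^ k := Finset.sum_congr rfl fun t _ => (hinterval _ (hJ t)).ncard_eq
    _ = 2 ^ k * T.card := by rw [Finset.sum_const, smul_eq_mul, mul_comm]

variable {V : Type*} {K : Complex V} {k : ℕ}

theorem IsBooleanInterval.exists_eq_Icc {I : Set K} (hI : IsBooleanInterval k I) :
    ∃ x y : K, I = Set.Icc x y ∧ x ≤ y ∧ (y : Finset V).card = (x : Finset V).card + k := by
  classical
  have hcard := hI.ncard_eq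
  obtain ⟨⟨x, y, rfl⟩, ⟨e⟩⟩ := hI
  have hxy : x ≤ y := (e.symm ∅).2.1.trans (e.symm ∅).2.2
  have hIcc : Subtype.val '' Set.Icc x y = (Finset.Icc x.1 y.1 : Set (Finset V)) := by
    rw [Finset.coe_Icc]
    ext σ
    constructor
    · rintro ⟨z, hz, rfl⟩
      exact hz
    · exact fun hσ => ⟨⟨σ, K.lower hσ.2 y.2⟩, hσ, rfl⟩
  rw [← Set.ncard_image_of_injective _ Subtype.val_injective, hIcc, Set.ncard_coe_finset,
    Finset.card_Icc_finset hxy] at hcard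
  have hk := Nat.pow_right_injective le_rfl hcard
  have := Finset.card_le_card hxy
  exact ⟨x, y, rfl, hxy, by omega⟩

/-- `T` meets every rank `k` interval `[σ, τ]` of the face poset of `K`. -/
def IsIntervalTransversal (k : ℕ) (K : Complex V) (T : Finset (Finset V)) : Prop :=
  ∀ ⦃σ τ : Finset V⦄, σ ⊆ τ → τ ∈ K → τ.card = σ.card + k → ∃ ρ ∈ T, σ ⊆ ρ ∧ ρ ⊆ τ

theorem isIntervalTransversal_generated_iff [DecidableEq V] {S T : Finset (Finset V)} :
    IsIntervalTransversal k (generated (S : Set (Finset V))) T ↔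
      ∀ X ∈ S, ∀ σ ∈ X.powerset, ∀ ν ∈ (X \ σ).powersetCard k, ∃ ρ ∈ T, σ ⊆ ρ ∧ ρ ⊆ σ ∪ ν := by
  simp only [Finset.mem_powerset, Finset.mem_powersetCard, Finset.subset_sdiff]
  constructor
  · rintro h X hX σ hσX ν ⟨⟨hνX, hνσ⟩, hν⟩
    refine h Finset.subset_union_left (mem_generated.2 ⟨X, hX, Finset.union_subset hσX hνX⟩) ?_
    rw [Finset.card_union_of_disjoint hνσ.symm, hν]
  · intro h σ τ hστ hτ hcard
    obtain ⟨X, hX, hτX⟩ := mem_generated.1 hτ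
    have := h X hX σ (hστ.trans hτX) (τ \ σ) ⟨⟨Finset.sdiff_subset.trans hτX,
      Finset.sdiff_disjoint⟩, by rw [Finset.card_sdiff_of_subset hστ]; omega⟩
    rwa [Finset.union_sdiff_of_subset hστ] at this

instance [DecidableEq V] {S T : Finset (Finset V)} :
    Decidable (IsIntervalTransversal k (generated (S : Set (Finset V))) T) :=
  decidable_of_iff' _ isIntervalTransversal_generated_iff

theorem IsIntervalTransversal.card_le {T : Finset (Finset V)} (hT : IsIntervalTransversal k K T)
    {B : Set (Set K)} (hB : IsBooleanDecomposition k B) : Nat.card K ≤ 2 ^ k * T.card := by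
  classical
  refine (hB.card_le (T := T.subtype (· ∈ K)) fun I hI => ?_).trans ?_
  · obtain ⟨x, y, rfl, hxy, hcard⟩ := (hB.1 I hI).exists_eq_Icc
    obtain ⟨ρ, hρ, hxρ, hρy⟩ := hT hxy y.2 hcard
    exact ⟨⟨ρ, K.lower hρy y.2⟩, Finset.mem_subtype.2 hρ, hxρ, hρy⟩
  · rw [Finset.card_subtype]
    exact Nat.mul_le_mul_left _ (Finset.card_filter_le _ _)

variable [LinearOrder V] {L : Complex V} {N : ℕ}

theorem IsIntervalTransversal.exists_glue {S T : Finset (Finset V)}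
    (h : IsIntervalTransversal k K (S ∪ T)) (hS : ∀ σ ∈ S, σ ∈ L) (hN : 0 < N) :
    ∃ U, IsIntervalTransversal k (glue K L N) U ∧ U.card ≤ S.card + N * T.card := by
  classical
  let U₀ := S.image (Finset.map (copyEmb L (⟨0, hN⟩ : Fin N)))
  let U₁ := Finset.univ.biUnion fun i : Fin N => T.image (Finset.map (copyEmb L i))
  refine ⟨U₀ ∪ U₁, ?_, ?_⟩
  · intro σ τ hστ hτ hcard
    obtain ⟨i, τ, hτK, rfl⟩ := mem_glue.1 hτ
    obtain ⟨σ, -, rfl⟩ := Finset.subset_map_iff.1 hστ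
    rw [Finset.card_map, Finset.card_map] at hcard
    obtain ⟨ρ, hρ, hσρ, hρτ⟩ := h (Finset.map_subset_map.1 hστ) hτK hcard
    refine ⟨ρ.map (copyEmb L i), ?_, Finset.map_subset_map.2 hσρ, Finset.map_subset_map.2 hρτ⟩
    rcases Finset.mem_union.1 hρ with hρS | hρT
    · rw [map_copyEmb_eq_of_mem (hS ρ hρS) i ⟨0, hN⟩]
      exact Finset.mem_union_left _ (Finset.mem_image_of_mem _ hρS)
    · exact Finset.mem_union_right _
        (Finset.mem_biUnion.2 ⟨i, Finset.mem_univ i, Finset.mem_image_of_mem _ hρT⟩)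
  · refine (Finset.card_union_le _ _).trans (Nat.add_le_add Finset.card_image_le ?_)
    refine (Finset.card_biUnion_le_card_mul _ _ _ fun i _ => Finset.card_image_le).trans_eq ?_
    rw [Finset.card_univ, Fintype.card_fin]

theorem card_glue [Finite V] (hL : IsInducedSubcomplex L K) (hN : 0 < N) :
    Nat.card (glue K L N) = Nat.card L + N * Nat.card (K \ L : Set (Finset V)) := by
  let f : L ⊕ Fin N × (K \ L : Set (Finset V)) → glue K L N :=
    Sum.elim
      (fun σ => ⟨σ.1.map (copyEmb L ⟨0, hN⟩), mem_glue.2 ⟨⟨0, hN⟩, σ.1, hL.le σ.2, rfl⟩⟩)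
      (fun p => ⟨p.2.1.map (copyEmb L p.1), mem_glue.2 ⟨p.1, p.2.1, p.2.2.1, rfl⟩⟩)
  have hinj : Function.Injective f := by
    rintro (⟨σ, hσ⟩ | ⟨i, σ, hσ⟩) (⟨τ, hτ⟩ | ⟨j, τ, hτ⟩) h <;>
      replace h := Subtype.ext_iff.1 h <;> simp only [f, Sum.elim_inl, Sum.elim_inr] at h
    · obtain rfl := Finset.map_injective _ h
      rfl
    · obtain rfl := eq_of_map_copyEmb_subset hL hτ.1 hτ.2 h.ge
      exact absurd (Finset.map_injective _ h ▸ hσ) hτ.2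
    · obtain rfl := eq_of_map_copyEmb_subset hL hσ.1 hσ.2 h.le
      exact absurd (Finset.map_injective _ h ▸ hτ) hσ.2
    · obtain rfl := eq_of_map_copyEmb_subset hL hσ.1 hσ.2 h.le
      obtain rfl := Finset.map_injective _ h
      rfl
  have hsurj : Function.Surjective f := by
    rintro ⟨_, hτ⟩
    obtain ⟨i, σ, hσ, rfl⟩ := mem_glue.1 hτ
    by_cases hσL : σ ∈ L
    · exact ⟨Sum.inl ⟨σ, hσL⟩, Subtype.ext (map_copyEmb_eq_of_mem hσL _ _)⟩
    · exact ⟨Sum.inr (i, ⟨σ, hσ, hσL⟩), rfl⟩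
  rw [← Nat.card_eq_of_bijective f ⟨hinj, hsurj⟩, Nat.card_sum, Nat.card_prod, Nat.card_fin]

theorem not_exists_isBooleanDecomposition_glue [Finite V] (hL : IsInducedSubcomplex L K)
    {S T : Finset (Finset V)} (h : IsIntervalTransversal k K (S ∪ T)) (hS : ∀ σ ∈ S, σ ∈ L)
    (hN : 0 < N) (hcard : 2 ^ k * (S.card + N * T.card) <
      Nat.card L + N * Nat.card (K \ L : Set (Finset V))) :
    ¬ ∃ B : Set (Set (glue K L N)), IsBooleanDecomposition k B := by
  rintro ⟨B, hB⟩
  obtain ⟨U, hU, hUcard⟩ := h.exists_glue hS hN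
  refine hcard.not_ge ?_
  rw [← card_glue hL hN]
  exact (hU.card_le hB).trans (Nat.mul_le_mul_left _ hUcard)

end BooleanIntervals

section Realization

variable {V : Type*} [Fintype V]

open Classical in
theorem mem_realization_iff {K : Complex V} {x : V → ℝ} :
    x ∈ realization K ↔ x ∈ stdSimplex ℝ V ∧ ({v | x v ≠ 0} : Finset V) ∈ K := by
  refine and_congr_right fun _ => ⟨?_, fun h => ⟨_, h, by simp⟩⟩
  rintro ⟨τ, hτ, h⟩
  convert hτ
  ext v
  simp [h]

theorem eq_zero_of_mem_realization {K : Complex V} {x : V → ℝ} (hx : x ∈ realization K) {v : V}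
    (hv : {v} ∉ K) : x v = 0 := by
  obtain ⟨-, τ, hτ, hsupp⟩ := hx
  by_contra hxv
  exact hv (K.lower (Finset.singleton_subset_iff.2 ((hsupp v).2 hxv)) hτ)

theorem mem_realization_generated_singleton {X : Finset V} {x : V → ℝ} :
    x ∈ realization (generated {X}) ↔ x ∈ stdSimplex ℝ V ∧ ∀ v ∉ X, x v = 0 := by
  simp only [mem_realization_iff, mem_generated, Set.mem_singleton_iff, exists_eq_left,
    Finset.subset_iff, Finset.mem_filter_univ, not_imp_comm]

end Realization

section Stellar

variable {V : Type*} [DecidableEq V]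

/-- The stellar subdivision of the complex `M` at `σ`, with `w` as the barycenter of `σ`. Only
faces of `M` that contain `σ` are replaced, so for `w` not a vertex of `M` this is `M` itself
if `σ` is not a face. -/
def stellar (M : Complex V) (σ : Finset V) (w : V) : Complex V where
  carrier := {τ | ¬ σ ⊆ τ ∧ (τ ∈ M ∨ τ.erase w ∪ σ ∈ M)}
  lower' := fun _ _ hρτ hτ =>
    ⟨fun h => hτ.1 (h.trans hρτ), hτ.2.imp (M.lower hρτ)
      (M.lower (Finset.union_subset_union_left (Finset.erase_subset_erase w hρτ)))⟩

/-- The facets of `stellar (generated S) σ w`. -/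
def stellarFacets (S : Finset (Finset V)) (σ : Finset V) (w : V) : Finset (Finset V) :=
  {X ∈ S | ¬ σ ⊆ X} ∪ {X ∈ S | σ ⊆ X}.biUnion fun X => σ.image fun v => insert w (X.erase v)

theorem stellar_generated (S : Finset (Finset V)) {σ : Finset V} {w : V} (hw : w ∉ σ) :
    stellar (generated (S : Set (Finset V))) σ w =
      generated (stellarFacets S σ w : Set (Finset V)) := by
  ext τ
  have hmem : τ ∈ stellar (generated (S : Set (Finset V))) σ w ↔
      ¬ σ ⊆ τ ∧ ((∃ X ∈ S, τ ⊆ X) ∨ ∃ X ∈ S, τ.erase w ∪ σ ⊆ X) := by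
    simp only [← Finset.mem_coe (s := S), ← mem_generated]
    rfl
  simp only [SetLike.mem_coe, hmem, mem_generated, stellarFacets, Finset.mem_union,
    Finset.mem_filter, Finset.mem_biUnion, Finset.mem_image]
  constructor
  · rintro ⟨hστ, h⟩
    obtain ⟨v, hvσ, hvτ⟩ := Finset.not_subset.1 hστ
    rcases h with ⟨X, hX, hτX⟩ | ⟨X, hX, hτX⟩
    · by_cases hσX : σ ⊆ X
      · exact ⟨_, Or.inr ⟨X, ⟨hX, hσX⟩, v, hvσ, rfl⟩, by grind⟩
      · exact ⟨X, Or.inl ⟨hX, hσX⟩, hτX⟩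
    · exact ⟨_, Or.inr ⟨X, ⟨hX, by grind⟩, v, hvσ, rfl⟩, by grind⟩
  · rintro ⟨_, ⟨hX, hσX⟩ | ⟨X, ⟨hX, hσX⟩, v, hv, rfl⟩, hτX⟩
    · exact ⟨fun h => hσX (h.trans hτX), Or.inl ⟨_, hX, hτX⟩⟩
    · exact ⟨fun h => by grind, Or.inr ⟨X, hX, by grind⟩⟩

/-- The map from the realization of `stellar M σ w` to that of `M` that is linear on faces and
sends the vertex `w` to the barycenter of `σ`. -/
noncomputable def spread (σ : Finset V) (w : V) (x : V → ℝ) (v : V) : ℝ :=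
  x v + (if v ∈ σ then x w / σ.card else 0) - if v = w then x w else 0

/-- The inverse of `spread σ w`: split off the largest possible multiple of the barycenter of `σ`
and let `w` carry it. -/
noncomputable def collect {σ : Finset V} (hσ : σ.Nonempty) (w : V) (y : V → ℝ) (v : V) : ℝ :=
  y v - (if v ∈ σ then σ.inf' hσ y else 0) + if v = w then σ.card * σ.inf' hσ y else 0

theorem continuous_spread (σ : Finset V) (w : V) : Continuous (spread σ w) := by
  refine continuous_pi fun v => ?_
  unfold spread
  split_ifs <;> fun_prop

theorem continuous_collect {σ : Finset V} (hσ : σ.Nonempty) (w : V) :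
    Continuous (collect hσ w) := by
  have hinf : Continuous fun y : V → ℝ => σ.inf' hσ y :=
    Continuous.finset_inf'_apply hσ fun v _ => continuous_apply v
  refine continuous_pi fun v => ?_
  unfold collect
  split_ifs <;> fun_prop

theorem spread_collect {σ : Finset V} {w : V} (hσ : σ.Nonempty) (hw : w ∉ σ) {y : V → ℝ}
    (hyw : y w = 0) : spread σ w (collect hσ w y) = y := by
  have hcard : (σ.card : ℝ) ≠ 0 := by exact_mod_cast hσ.card_ne_zero
  ext v
  simp only [spread, collect, hyw, hw, if_false, if_true, sub_zero, zero_add,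
    mul_div_cancel_left₀ _ hcard]
  split_ifs <;> ring

theorem collect_spread {σ : Finset V} {w : V} (hσ : σ.Nonempty) (hw : w ∉ σ) {x : V → ℝ}
    (hx : ∀ v ∈ σ, 0 ≤ x v) {u : V} (hu : u ∈ σ) (hxu : x u = 0) :
    collect hσ w (spread σ w x) = x := by
  have hcard : (σ.card : ℝ) ≠ 0 := by exact_mod_cast hσ.card_ne_zero
  have hspread {v : V} (hv : v ∈ σ) : spread σ w x v = x v + x w / σ.card := by
    simp [spread, hv, ne_of_mem_of_not_mem hv hw]
  have hinf : σ.inf' hσ (spread σ w x) = x w / σ.card := by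
    refine le_antisymm ((Finset.inf'_le _ hu).trans_eq ?_) (Finset.le_inf' _ _ fun v hv => ?_)
    · rw [hspread hu, hxu, zero_add]
    · rw [hspread hv]
      exact le_add_of_nonneg_left (hx v hv)
  ext v
  simp only [collect, hinf, spread, mul_div_cancel₀ _ hcard]
  ring

variable [Fintype V]

theorem sum_spread {σ : Finset V} (hσ : σ.Nonempty) (w : V) (x : V → ℝ) :
    ∑ v, spread σ w x v = ∑ v, x v := by
  have hcard : (σ.card : ℝ) ≠ 0 := by exact_mod_cast hσ.card_ne_zero
  simp only [spread, Finset.sum_sub_distrib, Finset.sum_add_distrib, Finset.sum_ite_mem,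
    Finset.univ_inter, Finset.sum_const, Finset.sum_ite_eq', Finset.mem_univ, if_true,
    nsmul_eq_mul, mul_div_cancel₀ _ hcard, add_sub_cancel_right]

theorem sum_collect {σ : Finset V} (hσ : σ.Nonempty) (w : V) (y : V → ℝ) :
    ∑ v, collect hσ w y v = ∑ v, y v := by
  simp only [collect, Finset.sum_sub_distrib, Finset.sum_add_distrib, Finset.sum_ite_mem,
    Finset.univ_inter, Finset.sum_const, Finset.sum_ite_eq', Finset.mem_univ, if_true,
    nsmul_eq_mul, sub_add_cancel]

variable {M : Complex V} {σ : Finset V} {w : V}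

theorem spread_mem_realization (hσ : σ.Nonempty) (hwM : {w} ∉ M) {x : V → ℝ}
    (hx : x ∈ realization (stellar M σ w)) : spread σ w x ∈ realization M := by
  classical
  obtain ⟨⟨hx0, hx1⟩, -, hsupp⟩ := mem_realization_iff.1 hx
  refine mem_realization_iff.2 ⟨⟨fun v => ?_, (sum_spread hσ w x).trans hx1⟩, ?_⟩
  · have hv : 0 ≤ x v - if v = w then x w else 0 := by
      split_ifs with hvw
      · rw [hvw, sub_self]
      · simpa using hx0 v
    have hvσ : 0 ≤ if v ∈ σ then x w / σ.card else 0 := by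
      have := hx0 w
      positivity
    unfold spread
    linarith
  · rcases hsupp with hM | hM
    · have hxw : x w = 0 := by
        by_contra hxw
        exact hwM (M.lower (Finset.singleton_subset_iff.2 (Finset.mem_filter_univ w |>.2 hxw)) hM)
      have hspread : spread σ w x = x := by ext v; simp [spread, hxw]
      rwa [hspread]
    · refine M.lower (fun v hv => ?_) hM
      rw [Finset.mem_filter_univ] at hv
      by_cases hvσ : v ∈ σ
      · exact Finset.mem_union_right _ hvσ
      · have hvw : v ≠ w := by
          rintro rfl
          exact hv (by simp [spread, hvσ])
        simpa [spread, hvσ, hvw] using hv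

theorem collect_mem_realization (hσ : σ.Nonempty) (hw : w ∉ σ) {y : V → ℝ}
    (hy : y ∈ realization M) : collect hσ w y ∈ realization (stellar M σ w) := by
  classical
  obtain ⟨⟨hy0, hy1⟩, hsupp⟩ := mem_realization_iff.1 hy
  obtain ⟨u, hu, huy⟩ := σ.exists_mem_eq_inf' hσ y
  have hinf : 0 ≤ σ.inf' hσ y := huy ▸ hy0 u
  refine mem_realization_iff.2 ⟨⟨fun v => ?_, (sum_collect hσ w y).trans hy1⟩, ?_, ?_⟩
  · refine add_nonneg (sub_nonneg.2 ?_) (by positivity)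
    split_ifs with hv
    · exact Finset.inf'_le _ hv
    · exact hy0 v
  · intro h
    have hne := h hu
    simp [collect, hu, huy, ne_of_mem_of_not_mem hu hw] at hne
  · rcases hinf.eq_or_lt with h0 | hpos
    · left
      have hcollect : collect hσ w y = y := by ext v; simp [collect, ← h0]
      rwa [hcollect]
    · right
      refine M.lower (Finset.union_subset (fun v hv => ?_) fun v hv => ?_) hsupp
      · obtain ⟨hvw, hv⟩ := Finset.mem_erase.1 hv
        rw [Finset.mem_filter_univ] at hv ⊢
        by_cases hvσ : v ∈ σ
        · exact (hpos.trans_le (Finset.inf'_le _ hvσ)).ne'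
        · simpa [collect, hvσ, hvw] using hv
      · exact Finset.mem_filter_univ _ |>.2 (hpos.trans_le (Finset.inf'_le _ hv)).ne'

/-- `spread σ w` as a homeomorphism, with inverse `collect hσ w`. -/
noncomputable def realizationStellarHomeomorph (hσ : σ.Nonempty) (hw : w ∉ σ) (hwM : {w} ∉ M) :
    realization (stellar M σ w) ≃ₜ realization M where
  toFun x := ⟨spread σ w x, spread_mem_realization hσ hwM x.2⟩
  invFun y := ⟨collect hσ w y, collect_mem_realization hσ hw y.2⟩
  left_inv x := by
    obtain ⟨⟨hx0, -⟩, τ, hτ, hsupp⟩ := x.2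
    obtain ⟨u, hu, huτ⟩ := Finset.not_subset.1 hτ.1
    exact Subtype.ext (collect_spread hσ hw (fun v _ => hx0 v) hu (by_contra (huτ ∘ (hsupp u).2)))
  right_inv y := Subtype.ext (spread_collect hσ hw (eq_zero_of_mem_realization y.2 hwM))
  continuous_toFun := ((continuous_spread σ w).comp continuous_subtype_val).subtype_mk _
  continuous_invFun := ((continuous_collect hσ w).comp continuous_subtype_val).subtype_mk _

theorem IsSimplicialBall.stellarFacets {d : ℕ} {S : Finset (Finset V)}
    (hS : IsSimplicialBall d (generated (S : Set (Finset V)))) (hσ : σ.Nonempty) (hwσ : w ∉ σ)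
    (hwS : w ∉ S.biUnion id) :
    IsSimplicialBall d (generated (stellarFacets S σ w : Set (Finset V))) := by
  rw [← stellar_generated S hwσ]
  exact hS.map (realizationStellarHomeomorph hσ hwσ (mt singleton_mem_generated.1 hwS)).trans

end Stellar

section Simplex

/-- The convex hull of the origin and the standard basis vectors in `ℝⁿ`. -/
def solidSimplex (n : ℕ) : Set (EuclideanSpace ℝ (Fin n)) := {p | (∀ i, 0 ≤ p i) ∧ ∑ i, p i ≤ 1}

theorem convex_solidSimplex (n : ℕ) : Convex ℝ (solidSimplex n) := by
  rintro p ⟨hp, hp'⟩ q ⟨hq, hq'⟩ a b ha hb hab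
  simp only [solidSimplex, Set.mem_ofPred_eq, PiLp.add_apply, PiLp.smul_apply, smul_eq_mul,
    Finset.sum_add_distrib, ← Finset.mul_sum]
  refine ⟨fun i => add_nonneg (mul_nonneg ha (hp i)) (mul_nonneg hb (hq i)), ?_⟩
  nlinarith

theorem isClosed_solidSimplex (n : ℕ) : IsClosed (solidSimplex n) := by
  simp only [solidSimplex, Set.ofPred_and, Set.ofPred_forall]
  exact (isClosed_iInter fun i => isClosed_le (by fun_prop) (by fun_prop)).inter
    (isClosed_le (by fun_prop) (by fun_prop))

theorem nonempty_interior_solidSimplex (n : ℕ) : (interior (solidSimplex n)).Nonempty := by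
  let U : Set (EuclideanSpace ℝ (Fin n)) := {p | (∀ i, 0 < p i) ∧ ∑ i, p i < 1}
  have hU : IsOpen U := by
    simp only [U, Set.ofPred_and, Set.ofPred_forall]
    exact (isOpen_iInter_of_finite fun i => isOpen_lt (by fun_prop) (by fun_prop)).inter
      (isOpen_lt (by fun_prop) (by fun_prop))
  have hUsub : U ⊆ solidSimplex n := fun p hp => ⟨fun i => (hp.1 i).le, hp.2.le⟩
  refine ⟨WithLp.toLp 2 fun _ => 1 / (n + 1 : ℝ), interior_maximal hUsub hU ⟨fun i => ?_, ?_⟩⟩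
  · change (0 : ℝ) < 1 / (n + 1)
    positivity
  · simp only [Finset.sum_const, Finset.card_univ, Fintype.card_fin, nsmul_eq_mul, mul_one_div]
    rw [div_lt_one (by positivity)]
    exact lt_add_one _

theorem isBounded_solidSimplex (n : ℕ) : Bornology.IsBounded (solidSimplex n) := by
  refine (Metric.isBounded_closedBall (x := 0) (r := 1)).subset fun p hp => ?_
  rw [mem_closedBall_zero_iff, EuclideanSpace.norm_eq, Real.sqrt_le_one]
  refine (Finset.sum_le_sum fun i _ => ?_).trans hp.2
  have hi : p i ≤ 1 :=
    (Finset.single_le_sum (fun j _ => hp.1 j) (Finset.mem_univ i)).trans hp.2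
  rw [Real.norm_of_nonneg (hp.1 i)]
  exact pow_le_of_le_one (hp.1 i) hi two_ne_zero

theorem nonempty_solidSimplex_homeomorph_closedBall (n : ℕ) :
    Nonempty (solidSimplex n ≃ₜ Metric.closedBall (0 : EuclideanSpace ℝ (Fin n)) 1) := by
  obtain ⟨h, -, hclosure, -⟩ := exists_homeomorph_image_interior_closure_frontier_eq_unitBall
    (convex_solidSimplex n) (nonempty_interior_solidSimplex n) (isBounded_solidSimplex n)
  rw [(isClosed_solidSimplex n).closure_eq] at hclosure
  exact ⟨(h.image _).trans (Homeomorph.setCongr hclosure)⟩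

variable {V : Type*} {n : ℕ}

/-- The point with barycentric coordinates `(1 - ∑ pᵢ, p₀, …, pₙ₋₁)` with respect to the
vertices `g 0, …, g n`. -/
noncomputable def barycentric (g : Fin (n + 1) ↪ V) (p : EuclideanSpace ℝ (Fin n)) : V → ℝ :=
  Function.extend g (Fin.cons (1 - ∑ i, p i) p) 0

theorem barycentric_apply_zero (g : Fin (n + 1) ↪ V) (p : EuclideanSpace ℝ (Fin n)) :
    barycentric g p (g 0) = 1 - ∑ i, p i :=
  g.injective.extend_apply _ _ _

theorem barycentric_apply_succ (g : Fin (n + 1) ↪ V) (p : EuclideanSpace ℝ (Fin n)) (i : Fin n) :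
    barycentric g p (g i.succ) = p i :=
  g.injective.extend_apply _ _ _

theorem barycentric_apply_of_notMem (g : Fin (n + 1) ↪ V) (p : EuclideanSpace ℝ (Fin n)) {v : V}
    (hv : v ∉ Finset.univ.map g) : barycentric g p v = 0 :=
  Function.extend_apply' _ _ _ (by simpa using hv)

theorem continuous_barycentric (g : Fin (n + 1) ↪ V) : Continuous (barycentric g) := by
  refine continuous_pi fun v => ?_
  by_cases hv : v ∈ Finset.univ.map g
  · obtain ⟨j, -, rfl⟩ := Finset.mem_map.1 hv
    cases j using Fin.cases with
    | zero => simp only [barycentric_apply_zero]; fun_prop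
    | succ i => simp only [barycentric_apply_succ]; fun_prop
  · simp only [barycentric_apply_of_notMem g _ hv]
    exact continuous_const

variable [Fintype V]

theorem sum_eq_add_sum_of_eq_zero (g : Fin (n + 1) ↪ V) {x : V → ℝ}
    (hx : ∀ v ∉ Finset.univ.map g, x v = 0) : ∑ v, x v = x (g 0) + ∑ i : Fin n, x (g i.succ) := by
  rw [← Fin.sum_univ_succ (fun i => x (g i)), ← Finset.sum_map Finset.univ g x]
  exact (Finset.sum_subset (Finset.subset_univ _) fun v _ hv => hx v hv).symm

theorem barycentric_mem_realization (g : Fin (n + 1) ↪ V) {p : EuclideanSpace ℝ (Fin n)}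
    (hp : p ∈ solidSimplex n) :
    barycentric g p ∈ realization (generated {Finset.univ.map g}) := by
  refine mem_realization_generated_singleton.2
    ⟨⟨fun v => ?_, ?_⟩, fun v => barycentric_apply_of_notMem g p⟩
  · by_cases hv : v ∈ Finset.univ.map g
    · obtain ⟨j, -, rfl⟩ := Finset.mem_map.1 hv
      cases j using Fin.cases with
      | zero => rw [barycentric_apply_zero]; exact sub_nonneg.2 hp.2
      | succ i => rw [barycentric_apply_succ]; exact hp.1 i
    · rw [barycentric_apply_of_notMem g p hv]
  · simp only [sum_eq_add_sum_of_eq_zero g fun _ => barycentric_apply_of_notMem g p,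
      barycentric_apply_zero, barycentric_apply_succ, sub_add_cancel]

/-- Forgetting the barycentric coordinate at `g 0` identifies the realization of the simplex with
vertices `g 0, …, g n` with the solid simplex. -/
noncomputable def realizationSimplexHomeomorph (g : Fin (n + 1) ↪ V) :
    realization (generated {Finset.univ.map g}) ≃ₜ solidSimplex n where
  toFun x := ⟨WithLp.toLp 2 fun i => x.1 (g i.succ), by
    obtain ⟨⟨hx0, hx1⟩, hx⟩ := mem_realization_generated_singleton.1 x.2
    refine ⟨fun i => hx0 _, ?_⟩
    rw [sum_eq_add_sum_of_eq_zero g hx] at hx1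
    exact hx1 ▸ le_add_of_nonneg_left (hx0 _)⟩
  invFun p := ⟨barycentric g p, barycentric_mem_realization g p.2⟩
  left_inv x := by
    obtain ⟨⟨-, hx1⟩, hx⟩ := mem_realization_generated_singleton.1 x.2
    rw [sum_eq_add_sum_of_eq_zero g hx] at hx1
    ext v
    by_cases hv : v ∈ Finset.univ.map g
    · obtain ⟨j, -, rfl⟩ := Finset.mem_map.1 hv
      cases j using Fin.cases with
      | zero => exact (barycentric_apply_zero g _).trans (eq_sub_of_add_eq hx1).symm
      | succ i => exact barycentric_apply_succ g _ i
    · exact (barycentric_apply_of_notMem g _ hv).trans (hx v hv).symm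
  right_inv p := by
    ext i
    exact barycentric_apply_succ g p i
  continuous_toFun := by
    refine Continuous.subtype_mk ((PiLp.continuous_toLp 2 _).comp (continuous_pi fun i => ?_)) _
    exact (continuous_apply (g i.succ)).comp continuous_subtype_val
  continuous_invFun := ((continuous_barycentric g).comp continuous_subtype_val).subtype_mk _

theorem isSimplicialBall_generated_singleton {X : Finset V} (hX : X.card = n + 1) :
    IsSimplicialBall n (generated {X}) := by
  obtain ⟨g, rfl⟩ : ∃ g : Fin (n + 1) ↪ V, Finset.univ.map g = X := by
    refine ⟨(Finset.equivFinOfCardEq hX).symm.toEmbedding.trans (Function.Embedding.subtype _), ?_⟩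
    rw [← Finset.map_map, Finset.map_univ_equiv, Finset.univ_eq_attach, Finset.attach_map_val]
  exact (nonempty_solidSimplex_homeomorph_closedBall n).map
    (realizationSimplexHomeomorph g).trans

end Simplex

section Counterexample

theorem isSimplicialBall_Γ : IsSimplicialBall 3 Γ := by
  have hBDFH : IsSimplicialBall 3 (generated (({{B, D, F, H}} : Finset (Finset (Fin 12))) :
      Set (Finset (Fin 12)))) := by
    rw [Finset.coe_singleton]
    exact isSimplicialBall_generated_singleton (by decide)
  have hsubdivided := (((hBDFH.stellarFacets (σ := {D, F, H}) (w := C)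
    (by decide) (by decide) (by decide)).stellarFacets (σ := {C, F, H}) (w := G)
    (by decide) (by decide) (by decide)).stellarFacets (σ := {C, F, G}) (w := E)
    (by decide) (by decide) (by decide)).stellarFacets (σ := {C, E, G}) (w := A)
    (by decide) (by decide) (by decide)
  have hΓ : stellarFacets (stellarFacets (stellarFacets (stellarFacets {{B, D, F, H}}
      {D, F, H} C) {C, F, H} G) {C, F, G} E) {C, E, G} A = facetsΓ := by decide
  rwa [hΓ] at hsubdivided

theorem isInducedSubcomplex_Γ_Δ : IsInducedSubcomplex Γ Δ := by
  refine ⟨Finset.Iic H, ?_⟩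
  rw [Δ, Γ, induced_generated]
  exact le_antisymm (by decide +kernel) (by decide +kernel)

theorem isLowerSet_vertices_Γ : IsLowerSet {v | {v} ∈ Γ} := by
  have hvertices : {v | {v} ∈ Γ} = Set.Iic H := by
    ext v
    rw [Set.mem_ofPred_eq, Γ, singleton_mem_generated,
      show facetsΓ.biUnion id = Finset.Iic H by decide, Finset.mem_Iic, Set.mem_Iic]
  exact hvertices ▸ isLowerSet_Iic H

theorem hasDim_Δ : HasDim Δ 3 := by
  have hsup : (facetsΓ ∪ otherFacetsΔ).sup Finset.card = 4 := by decide +kernel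
  have hdim := hasDim_generated (S := facetsΓ ∪ otherFacetsΔ) ⟨{A, B, C, E}, by decide +kernel⟩
  rwa [hsup] at hdim

theorem card_Γ : Nat.card Γ = 64 := by
  change (Γ : Set (Finset (Fin 12))).ncard = 64
  rw [Γ, coe_generated, Set.ncard_coe_finset]
  decide +kernel

theorem card_Δ_diff_Γ : Nat.card (Δ \ Γ : Set (Finset (Fin 12))) = 136 := by
  rw [Nat.card_coe_set_eq, Δ, Γ, coe_generated_sdiff_generated,
    Set.ncard_coe_finset]
  decide +kernel

/-- An acyclic order of the facets of `Γ`; its restriction to the star of any vertex is again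
acyclic. -/
def facetOrderΓ : List (Finset (Fin 12)) :=
  [{B, C, D, H}, {B, C, G, H}, {B, F, G, H}, {A, B, C, G}, {B, C, D, F}, {B, C, E, F},
   {A, B, C, E}, {B, E, F, G}, {A, B, E, G}]

/-- An acyclic order of the facets of `Δ`. -/
def facetOrderΔ : List (Finset (Fin 12)) :=
  [{C, D, I, J}, {G, H, I, L}, {E, F, J, K}, {B, C, D, H}, {C, D, J, K}, {A, B, C, G},
   {B, C, I, J}, {C, D, J, L}, {G, H, J, L}, {C, D, H, L}, {C, H, J, L}, {C, G, H, J},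
   {B, C, D, I}, {B, C, D, F}, {A, B, E, G}, {B, C, E, F}, {B, G, H, I}, {C, F, J, K},
   {A, B, I, J}, {A, B, C, J}, {E, F, G, L}, {A, B, I, K}, {B, C, G, H}, {G, H, K, L},
   {A, B, G, L}, {E, F, K, L}, {F, G, K, L}, {F, G, H, K}, {B, E, I, K}, {A, B, E, K},
   {E, F, I, K}, {B, F, G, H}, {A, B, I, L}, {B, E, F, I}, {B, G, I, L}, {B, E, F, G},
   {A, B, C, E}, {C, D, F, K}, {C, E, F, J}]

/-- Acyclic orders of the facets of the vertex links of `Δ`. -/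
def linkFacetOrderΔ : Fin 12 → List (Finset (Fin 12)) := ![
   [{B, I, K}, {B, E, K}, {B, E, G}, {B, G, L}, {B, C, G}, {B, I, L}, {B, I, J}, {B, C, E},
    {B, C, J}],
   [{G, H, I}, {C, D, H}, {G, I, L}, {A, I, L}, {C, G, H}, {A, C, G}, {C, D, F}, {C, E, F},
    {A, C, E}, {A, C, J}, {A, I, J}, {A, G, L}, {A, E, G}, {E, F, G}, {C, D, I}, {A, E, K},
    {F, G, H}, {E, F, I}, {E, I, K}, {A, I, K}, {C, I, J}],
   [{A, B, E}, {B, E, F}, {B, D, F}, {D, F, K}, {A, B, J}, {G, H, J}, {D, J, K}, {B, I, J},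
    {B, D, I}, {F, J, K}, {D, I, J}, {B, G, H}, {A, B, G}, {B, D, H}, {D, H, L}, {E, F, J},
    {H, J, L}, {D, J, L}],
   [{C, H, L}, {B, C, H}, {B, C, F}, {B, C, I}, {C, I, J}, {C, F, K}, {C, J, L}, {C, J, K}],
   [{A, B, K}, {B, I, K}, {F, G, L}, {F, J, K}, {A, B, C}, {B, C, F}, {C, F, J}, {A, B, G},
    {F, I, K}, {B, F, G}, {F, K, L}, {B, F, I}],
   [{B, C, D}, {B, C, E}, {B, E, I}, {B, E, G}, {E, G, L}, {E, I, K}, {G, K, L}, {C, D, K},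
    {C, J, K}, {E, J, K}, {C, E, J}, {E, K, L}, {G, H, K}, {B, G, H}],
   [{A, B, E}, {E, F, L}, {F, K, L}, {H, K, L}, {H, J, L}, {H, I, L}, {B, H, I}, {B, I, L},
    {C, H, J}, {B, C, H}, {A, B, C}, {B, E, F}, {F, H, K}, {A, B, L}, {B, F, H}],
   [{B, G, I}, {C, D, L}, {F, G, K}, {C, J, L}, {G, J, L}, {G, I, L}, {B, F, G}, {B, C, D},
    {B, C, G}, {G, K, L}, {C, G, J}],
   [{B, E, F}, {A, B, J}, {B, C, J}, {A, B, L}, {B, G, L}, {C, D, J}, {B, C, D}, {A, B, K},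
    {G, H, L}, {B, G, H}, {E, F, K}, {B, E, K}],
   [{A, B, C}, {A, B, I}, {C, E, F}, {B, C, I}, {G, H, L}, {C, H, L}, {C, D, K}, {E, F, K},
    {C, G, H}, {C, D, I}, {C, D, L}, {C, F, K}],
   [{G, H, L}, {A, B, E}, {B, E, I}, {C, D, F}, {E, F, L}, {E, F, J}, {F, G, L}, {A, B, I},
    {E, F, I}, {F, G, H}, {C, D, J}, {C, F, J}],
   [{C, D, J}, {C, H, J}, {G, H, K}, {G, H, I}, {A, B, G}, {E, F, G}, {C, D, H}, {G, H, J},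
    {E, F, K}, {F, G, K}, {B, G, I}, {A, B, I}]]

theorem foldAcyclic_Γ (𝕜 : Type*) [Field 𝕜] : FoldAcyclic 𝕜 2 Γ :=
  foldAcyclic_two_generated 𝕜 (l := facetOrderΓ)
    (linkOrder := fun v => (facetOrderΓ.filter (v ∈ ·)).map (Finset.erase · v))
    (by decide +kernel) (by decide +kernel) (by decide +kernel) (by decide +kernel)

theorem foldAcyclic_Δ (𝕜 : Type*) [Field 𝕜] : FoldAcyclic 𝕜 2 Δ :=
  foldAcyclic_two_generated 𝕜 (l := facetOrderΔ) (linkOrder := linkFacetOrderΔ)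
    (by decide +kernel) (by decide +kernel) (by decide +kernel) (by decide +kernel)

/-- The faces of `Γ` in the interval transversal of `Δ`. -/
def transversalΓ : Finset (Finset (Fin 12)) := {σ ∈ facetsΓ.biUnion Finset.powerset | σ.card ≤ 2}

/-- The faces outside `Γ` in the interval transversal of `Δ`. -/
def transversalΔ : Finset (Finset (Fin 12)) :=
  {{B, I}, {C, J}, {E, K}, {F, K}, {G, L}, {H, L}, {I, J}, {I, K}, {I, L}, {J, K}, {J, L},
   {K, L}, {A, B, I}, {A, B, J}, {A, B, K}, {A, B, L}, {C, D, I}, {C, D, J}, {C, D, K},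
   {C, D, L}, {E, F, I}, {E, F, J}, {E, F, L}, {G, H, I}, {G, H, J}, {G, H, K}, {B, C, I, J},
   {B, E, I, K}, {B, G, I, L}, {C, F, J, K}, {C, H, J, L}, {F, G, K, L}}

theorem isIntervalTransversal_Δ : IsIntervalTransversal 2 Δ (transversalΓ ∪ transversalΔ) := by
  unfold Δ
  decide +kernel

theorem mem_Γ_of_mem_transversalΓ {σ : Finset (Fin 12)} (hσ : σ ∈ transversalΓ) : σ ∈ Γ := by
  rw [Γ, ← SetLike.mem_coe, coe_generated]
  exact (Finset.mem_filter.1 hσ).1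

theorem not_exists_isBooleanDecomposition_Ω {N : ℕ} (hN : 8 ≤ N) :
    ¬ ∃ B : Set (Set (Ω N)), IsBooleanDecomposition 2 B := by
  refine not_exists_isBooleanDecomposition_glue isInducedSubcomplex_Γ_Δ isIntervalTransversal_Δ
    (fun _ => mem_Γ_of_mem_transversalΓ) (by omega) ?_
  rw [card_Γ, card_Δ_diff_Γ, show transversalΓ.card = 31 by decide +kernel,
    show transversalΔ.card = 32 by decide +kernel]
  omega

theorem foldAcyclic_Ω (𝕜 : Type*) [Field 𝕜] (N : ℕ) : FoldAcyclic 𝕜 2 (Ω N) :=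
  (foldAcyclic_Δ 𝕜).glue (foldAcyclic_Γ 𝕜) isInducedSubcomplex_Γ_Δ isLowerSet_vertices_Γ N

theorem not_stanleyConjecture (𝕜 : Type*) [Field 𝕜] : ¬ StanleyConjecture 𝕜 := by
  intro h
  have : Fintype (Fin 12 ⊕ₗ (Fin 8 ×ₗ Fin 12)) :=
    inferInstanceAs (Fintype (Fin 12 ⊕ (Fin 8 × Fin 12)))
  obtain ⟨𝓑, h𝓑, -⟩ := h (Fin 12 ⊕ₗ (Fin 8 ×ₗ Fin 12)) 2 (Ω 8) (foldAcyclic_Ω 𝕜 8)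
  exact not_exists_isBooleanDecomposition_Ω le_rfl ⟨𝓑, h𝓑⟩

end Counterexample

end BoolDecomp

theorem mainTheorem1_general (𝕜 : Type*) [Field 𝕜] {N : ℕ} (hN : 8 ≤ N) :
    BoolDecomp.IsSimplicialBall 3 BoolDecomp.Γ ∧
    BoolDecomp.IsInducedSubcomplex BoolDecomp.Γ BoolDecomp.Δ ∧
    BoolDecomp.HasDim (BoolDecomp.Ω N) 3 ∧
    BoolDecomp.FoldAcyclic 𝕜 2 (BoolDecomp.Ω N) ∧
    (¬ ∃ B : Set (Set (BoolDecomp.Ω N)), BoolDecomp.IsBooleanDecomposition 2 B) ∧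
    ¬ BoolDecomp.StanleyConjecture 𝕜 :=
  ⟨BoolDecomp.isSimplicialBall_Γ, BoolDecomp.isInducedSubcomplex_Γ_Δ,
    BoolDecomp.hasDim_Δ.glue (by omega), BoolDecomp.foldAcyclic_Ω 𝕜 N,
    BoolDecomp.not_exists_isBooleanDecomposition_Ω hN, BoolDecomp.not_stanleyConjecture 𝕜⟩

theorem mainTheorem1 (𝕜 : Type*) [Field 𝕜] :
    BoolDecomp.IsSimplicialBall 3 BoolDecomp.Γ ∧
    BoolDecomp.IsInducedSubcomplex BoolDecomp.Γ BoolDecomp.Δ ∧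
    BoolDecomp.HasDim (BoolDecomp.Ω 17) 3 ∧
    BoolDecomp.FoldAcyclic 𝕜 2 (BoolDecomp.Ω 17) ∧
    (¬ ∃ B : Set (Set (BoolDecomp.Ω 17)), BoolDecomp.IsBooleanDecomposition 2 B) ∧
    ¬ BoolDecomp.StanleyConjecture 𝕜 :=
  mainTheorem1_general 𝕜 (by norm_num)
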